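/- Let $n\ge 2$ and let $M$ be an $n\times n$ complex matrix. The $r$-rigidity $\mathrm{Rig}_r(A)$ of an $n\times n$ complex matrix $A$ is the smallest $s$ such that $A=B+C$ with $\operatorname{rank}B\le r$ and $C$ having exactly $s$ nonzero entries. Let $\hat{\mathcal R}[n,r,s]$ be the Zariski closure, in the space $\mathrm{Mat}_n(\mathbb C)$ of $n\times n$ complex matrices, of $\{A : \mathrm{Rig}_r(A)\le s\}$, that is, the common zero set of all polynomials in the matrix entries that vanish on this set. For $r\le n-2$, $M$ is called maximally $r$-border rigid if $M\notin\hat{\mathcal R}[n,r,(n-r)^2-1]$. For indices $i,j\in[n]=\{1,\dots,n\}$ let $\Delta^{i}_{j}$ be the determinant of the submatrix obtained by deleting row $i$ and column $j$. For $i\ne i'$ and $j\ne j'$ let $\Delta^{ii'}_{jj'}$ be the determinant of the submatrix obtained by deleting rows $i,i'$ and columns $j,j'$ if $i<i'$ and $j<j'$, extended to all ordered pairs of distinct indices by $\Delta^{i'i}_{jj'}=\Delta^{ii'}_{j'j}=-\Delta^{ii'}_{jj'}$. (Remaining rows and columns are kept in increasing order.) Then $M$ is maximally $(n-2)$-border rigid,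 i.e. $M\notin\hat{\mathcal R}[n,n-2,3]$, if and only if both of the following hold: 1. no minor of $M$ of size $n-1$ is zero; 2. for all triples $(i_1,i_2,i_3)$ of distinct elements of $[n]$ and all triples $(j_1,j_2,j_3)$ of distinct elements of $[n]$, the polynomial $$\Delta^{i_1}_{j_1}\Delta^{i_2i_3}_{j_2j_3}-\Delta^{i_2}_{j_2}\Delta^{i_1i_3}_{j_1j_3}$$ does not vanish at $M$. -/

import Mathlib

/-- The `r`-rigidity of a complex `n × n` matrix `M`: the least `s` such that `M = A + B` with
`A` of rank at most `r` and `B` having exactly `s` nonzero entries. (The set is never empty: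
take `A = 0`.) -/
noncomputable def rigidity {n : ℕ} (r : ℕ) (M : Matrix (Fin n) (Fin n) ℂ) : ℕ :=
  sInf {s : ℕ | ∃ A B : Matrix (Fin n) (Fin n) ℂ,
    M = A + B ∧ A.rank ≤ r ∧ {p : Fin n × Fin n | B p.1 p.2 ≠ 0}.ncard = s}

/-- The set of `n × n` matrices of `r`-rigidity at most `s`. -/
def rigiditySet (n r s : ℕ) : Set (Matrix (Fin n) (Fin n) ℂ) :=
  {M | rigidity r M ≤ s}

/-- The value at the matrix `M` of a polynomial in the `n ^ 2` matrix entries. -/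
noncomputable def evalAt {n : ℕ} (P : MvPolynomial (Fin n × Fin n) ℂ)
    (M : Matrix (Fin n) (Fin n) ℂ) : ℂ :=
  MvPolynomial.eval (fun p => M p.1 p.2) P

/-- Zariski closure in the affine space of `n × n` matrices: the common zero set of all
polynomials vanishing on `X`. -/
def zariskiClosure {n : ℕ} (X : Set (Matrix (Fin n) (Fin n) ℂ)) :
    Set (Matrix (Fin n) (Fin n) ℂ) :=
  {M | ∀ P : MvPolynomial (Fin n × Fin n) ℂ, (∀ A ∈ X, evalAt P A = 0) → evalAt P M = 0}

/-- The variety of `n × n` matrices of `r`-border rigidity at most `s`. -/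
def borderRigidityVariety (n r s : ℕ) : Set (Matrix (Fin n) (Fin n) ℂ) :=
  zariskiClosure (rigiditySet n r s)

/-- `M` is maximally `r`-border rigid (a notion used for `r ≤ n - 2`, so that the natural-number
subtractions are genuine ones). -/
def IsMaximallyBorderRigid {n : ℕ} (r : ℕ) (M : Matrix (Fin n) (Fin n) ℂ) : Prop :=
  M ∉ borderRigidityVariety n r ((n - r) ^ 2 - 1)

/-- The minor of `M` on the rows in `I` and the columns in `J`, where `#I = #J`; rows and columns
are taken in increasing order. (Set to `0` when `#I ≠ #J`, where there is no minor.) -/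
noncomputable def minorOn {n : ℕ} (M : Matrix (Fin n) (Fin n) ℂ) (I J : Finset (Fin n)) : ℂ :=
  if h : J.card = I.card then
    (M.submatrix (I.orderEmbOfFin rfl) (J.orderEmbOfFin h)).det
  else 0

/-- `Δ^i_j`: the minor of `M` obtained by deleting row `i` and column `j`. -/
noncomputable def delta₁ {n : ℕ} (M : Matrix (Fin n) (Fin n) ℂ) (i j : Fin n) : ℂ :=
  minorOn M {i}ᶜ {j}ᶜ

/-- The sign of an ordered pair of distinct indices: `1` if it is increasing, else `-1`. -/
def pairSign {n : ℕ} (a b : Fin n) : ℂ := if a < b then 1 else -1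

/-- `Δ^{i i'}_{j j'}`: the minor of `M` obtained by deleting the rows `i ≠ i'` and the columns
`j ≠ j'`, with the usual alternating convention for ordered multi-indices: it is the minor itself
when `i < i'` and `j < j'`, and it changes sign when `i, i'` or `j, j'` are exchanged. -/
noncomputable def delta₂ {n : ℕ} (M : Matrix (Fin n) (Fin n) ℂ) (i i' j j' : Fin n) : ℂ :=
  pairSign i i' * pairSign j j' * minorOn M {i, i'}ᶜ {j, j'}ᶜ

open Matrix Filter Topology

/-! ### Minors as determinants with rows replaced by unit vectors -/

/-! Suppose `A` agrees with some `B` of rank at most `n - 2` outside three positions. If two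
positions share a row or a column, one row and one column cover all three, so an `(n - 1)`-minor of
`A` is a minor of `B`, hence zero. Otherwise label them `(i₁, j₂)`, `(i₂, j₁)`, `(i₃, j₃)`: the
cofactors of `A` at `(i₁, j₁)` and `(i₂, j₂)` see only the third, and eliminating its perturbation
gives the polynomial of condition 2 (`cofactorDet_eq_zero`). The product of these finitely many
polynomials vanishes on the closure.

Conversely, a vanishing `(n - 1)`-minor puts `M` in the rigidity set itself
(`mem_rigiditySet_of_cofactor₁_eq_zero`). If no such minor vanishes and `M` is invertible, Jacobi's
identity turns condition 2 failing into equality of the two off-diagonal 3-cycle products of a `3 ×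
3` submatrix of `M⁻¹`. As its entries are nonzero, that submatrix is diagonal plus rank one. When
the diagonal part is invertible, subtracting its reciprocals from three entries of `M` leaves rank
at most `n - 2`; a small diagonal shift reduces to this case, so `M` is a limit. A singular `M` is a
limit of invertible matrices satisfying the same equation. Zariski closures are closed under
Euclidean limits. -/

theorem minorOn_eq_det_submatrix {n k : ℕ} (M : Matrix (Fin n) (Fin n) ℂ) {I J : Finset (Fin n)}
    {f g : Fin k → Fin n} (hf : StrictMono f) (hg : StrictMono g) (hI : I.card = k)
    (hJ : J.card = k) (hfI : ∀ x, f x ∈ I) (hgJ : ∀ x, g x ∈ J) :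
    minorOn M I J = (M.submatrix f g).det := by
  subst hI
  rw [minorOn, dif_pos hJ, ← Finset.orderEmbOfFin_unique rfl hfI hf,
    ← Finset.orderEmbOfFin_unique hJ hgJ hg]

theorem minorOn_congr {n : ℕ} {A B : Matrix (Fin n) (Fin n) ℂ} {I J : Finset (Fin n)}
    (h : ∀ i ∈ I, ∀ j ∈ J, A i j = B i j) : minorOn A I J = minorOn B I J := by
  unfold minorOn
  split_ifs with hc
  · congr 1
    ext a b
    exact h _ (Finset.orderEmbOfFin_mem _ _ _) _ (Finset.orderEmbOfFin_mem _ _ _)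
  · rfl

/-- The `(i, j)` cofactor of `M`. -/
noncomputable def cofactor₁ {n : ℕ} (M : Matrix (Fin n) (Fin n) ℂ) (i j : Fin n) : ℂ :=
  (M.updateRow i (Pi.single j 1)).det

/-- The second-order cofactor of `M` at the rows `i, i'` and the columns `j, j'`. -/
noncomputable def cofactor₂ {n : ℕ} (M : Matrix (Fin n) (Fin n) ℂ) (i i' j j' : Fin n) : ℂ :=
  ((M.updateRow i (Pi.single j 1)).updateRow i' (Pi.single j' 1)).det

theorem det_updateRow_single {m : ℕ} (M : Matrix (Fin (m + 1)) (Fin (m + 1)) ℂ)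
    (i j : Fin (m + 1)) :
    (M.updateRow i (Pi.single j 1)).det
      = (-1) ^ (i + j : ℕ) * (M.submatrix i.succAbove j.succAbove).det := by
  rw [← adjugate_apply, adjugate_fin_succ_eq_det_submatrix]

theorem cofactor₁_eq {n : ℕ} (M : Matrix (Fin n) (Fin n) ℂ) (i j : Fin n) :
    cofactor₁ M i j = (-1) ^ (i + j : ℕ) * delta₁ M i j := by
  obtain _ | m := n
  · exact i.elim0
  rw [cofactor₁, det_updateRow_single, delta₁,
    minorOn_eq_det_submatrix M i.strictMono_succAbove j.strictMono_succAbove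
      (by simp [Finset.card_compl]) (by simp [Finset.card_compl]) (by simp) (by simp)]

/-- Deleting index `i` lowers by one exactly the later indices; this parity change is what the
alternating convention for `delta₂` absorbs. -/
theorem neg_one_pow_succAbove {m : ℕ} (i : Fin (m + 1)) (a : Fin m) :
    (-1 : ℂ) ^ (a : ℕ) = -((-1) ^ (i.succAbove a : ℕ) * pairSign i (i.succAbove a)) := by
  rcases lt_or_ge a.castSucc i with h | h
  · rw [Fin.succAbove_of_castSucc_lt _ _ h, pairSign, if_neg h.not_gt]
    simp
  · rw [Fin.succAbove_of_le_castSucc _ _ h, pairSign,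
      if_pos (lt_of_le_of_lt h (Fin.castSucc_lt_succ))]
    simp [pow_succ]

theorem cofactor₂_eq {n : ℕ} (M : Matrix (Fin n) (Fin n) ℂ) {i i' j j' : Fin n}
    (hi : i ≠ i') (hj : j ≠ j') :
    cofactor₂ M i i' j j' = (-1) ^ (i + i' + j + j' : ℕ) * delta₂ M i i' j j' := by
  obtain _ | _ | m := n
  · exact i.elim0
  · exact absurd (Subsingleton.elim (α := Fin 1) _ _) hi
  obtain ⟨a, rfl⟩ := Fin.exists_succAbove_eq hi.symm
  obtain ⟨b, rfl⟩ := Fin.exists_succAbove_eq hj.symm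
  have hsub : (M.updateRow (i.succAbove a) (Pi.single (j.succAbove b) 1)).submatrix
      i.succAbove j.succAbove
      = (M.submatrix i.succAbove j.succAbove).updateRow a (Pi.single b 1) := by
    ext x y
    rcases eq_or_ne x a with rfl | hx
    · simp [Pi.single_apply]
    · rw [updateRow_ne hx, submatrix_apply, submatrix_apply, updateRow_ne]
      simpa using hx
  have hcard : ∀ (i : Fin (m + 2)) (a : Fin (m + 1)),
      ({i, i.succAbove a}ᶜ : Finset (Fin (m + 2))).card = m := by
    intro i a
    rw [Finset.card_compl, Finset.card_pair (Fin.succAbove_ne i a).symm]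
    simp
  rw [cofactor₂, updateRow_comm _ hi, det_updateRow_single, hsub, det_updateRow_single,
    submatrix_submatrix, delta₂,
    minorOn_eq_det_submatrix M (i.strictMono_succAbove.comp a.strictMono_succAbove)
      (j.strictMono_succAbove.comp b.strictMono_succAbove) (hcard i a) (hcard j b)
      (by simp [Fin.succAbove_ne]) (by simp [Fin.succAbove_ne])]
  simp only [pow_add, neg_one_pow_succAbove i a, neg_one_pow_succAbove j b]
  ring

theorem cofactor₁_congr {n : ℕ} {A B : Matrix (Fin n) (Fin n) ℂ} {i j : Fin n}
    (h : ∀ a b, a ≠ i → b ≠ j → A a b = B a b) : cofactor₁ A i j = cofactor₁ B i j := by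
  rw [cofactor₁_eq, cofactor₁_eq, delta₁, delta₁, minorOn_congr]
  simpa using fun a ha b hb => h a b ha hb

theorem cofactor₂_congr {n : ℕ} {A B : Matrix (Fin n) (Fin n) ℂ} {i i' j j' : Fin n}
    (hi : i ≠ i') (hj : j ≠ j')
    (h : ∀ a b, a ≠ i → a ≠ i' → b ≠ j → b ≠ j' → A a b = B a b) :
    cofactor₂ A i i' j j' = cofactor₂ B i i' j j' := by
  rw [cofactor₂_eq _ hi hj, cofactor₂_eq _ hi hj, delta₂, delta₂, minorOn_congr]
  intro a ha b hb
  simp only [Finset.mem_compl, Finset.mem_insert, Finset.mem_singleton, not_or] at ha hb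
  exact h a b ha.1 ha.2 hb.1 hb.2

theorem add_single_eq_updateRow {n : ℕ} (A : Matrix (Fin n) (Fin n) ℂ) (i j : Fin n) (c : ℂ) :
    A + single i j c = A.updateRow i (A i + c • Pi.single j 1) := by
  ext a b
  rcases eq_or_ne a i with rfl | ha
  · rcases eq_or_ne b j with rfl | hb
    · simp
    · simp [hb, hb.symm]
  · simp [ha, ha.symm, updateRow_ne]

theorem det_add_single {n : ℕ} (A : Matrix (Fin n) (Fin n) ℂ) (i j : Fin n) (c : ℂ) :
    (A + single i j c).det = A.det + c * cofactor₁ A i j := by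
  rw [add_single_eq_updateRow, det_updateRow_add, det_updateRow_smul, updateRow_eq_self, cofactor₁]

theorem cofactor₁_add_single {n : ℕ} (A : Matrix (Fin n) (Fin n) ℂ) {i i' : Fin n} (j j' : Fin n)
    (c : ℂ) (hi : i ≠ i') :
    cofactor₁ (A + single i' j' c) i j = cofactor₁ A i j + c * cofactor₂ A i i' j j' := by
  have h : (A + single i' j' c).updateRow i (Pi.single j 1)
      = A.updateRow i (Pi.single j 1) + single i' j' c := by
    rw [add_single_eq_updateRow, add_single_eq_updateRow, updateRow_comm _ hi.symm,
      updateRow_ne hi.symm]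
  rw [cofactor₁, h, det_add_single, cofactor₁, cofactor₁, cofactor₂]

/-- The polynomial of the second condition, expressed through cofactors. -/
noncomputable def cofactorDet {n : ℕ} (M : Matrix (Fin n) (Fin n) ℂ) (i₁ i₂ i₃ j₁ j₂ j₃ : Fin n) :
    ℂ :=
  cofactor₁ M i₁ j₁ * cofactor₂ M i₂ i₃ j₂ j₃ - cofactor₁ M i₂ j₂ * cofactor₂ M i₁ i₃ j₁ j₃

theorem cofactorDet_eq {n : ℕ} (M : Matrix (Fin n) (Fin n) ℂ) {i₁ i₂ i₃ j₁ j₂ j₃ : Fin n}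
    (hi₁₃ : i₁ ≠ i₃) (hi₂₃ : i₂ ≠ i₃) (hj₁₃ : j₁ ≠ j₃) (hj₂₃ : j₂ ≠ j₃) :
    cofactorDet M i₁ i₂ i₃ j₁ j₂ j₃ = (-1) ^ (i₁ + i₂ + i₃ + j₁ + j₂ + j₃ : ℕ) *
      (delta₁ M i₁ j₁ * delta₂ M i₂ i₃ j₂ j₃ - delta₁ M i₂ j₂ * delta₂ M i₁ i₃ j₁ j₃) := by
  rw [cofactorDet, cofactor₁_eq, cofactor₁_eq, cofactor₂_eq _ hi₂₃ hj₂₃, cofactor₂_eq _ hi₁₃ hj₁₃]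
  simp only [pow_add]
  ring

/-! ### Rank -/

theorem rank_le_sub_two {n : ℕ} {A : Matrix (Fin n) (Fin n) ℂ} {u w : Fin n → ℂ} {a b : Fin n}
    (hab : u a * w b - u b * w a ≠ 0) (hu : A *ᵥ u = 0) (hw : A *ᵥ w = 0) : A.rank ≤ n - 2 := by
  have hind : LinearIndependent ℂ
      ![(⟨u, hu⟩ : LinearMap.ker A.mulVecLin), ⟨w, hw⟩] := by
    rw [LinearIndependent.pair_iff]
    intro s t hst
    have h : ∀ x, s * u x + t * w x = 0 := fun x => by
      simpa using congrFun (congrArg Subtype.val hst) x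
    constructor
    · refine (mul_eq_zero.mp ?_).resolve_right hab
      linear_combination w b * h a - w a * h b
    · refine (mul_eq_zero.mp ?_).resolve_right hab
      linear_combination u a * h b - u b * h a
  have h2 := hind.fintype_card_le_finrank
  have h3 := A.mulVecLin.finrank_range_add_finrank_ker
  simp only [Fintype.card_fin, Module.finrank_fintype_fun_eq_card] at h2 h3
  rw [Matrix.rank]
  omega

/-- Independence is recorded as a nonzero `2 × 2` minor because `a` and `b` later tell which two
entries can be corrected by Cramer's rule. -/
theorem exists_pair_of_rank_le {n : ℕ} (hn : 2 ≤ n) {A : Matrix (Fin n) (Fin n) ℂ}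
    (hA : A.rank ≤ n - 2) :
    ∃ (u w : Fin n → ℂ) (a b : Fin n),
      u a * w b - u b * w a ≠ 0 ∧ A *ᵥ u = 0 ∧ A *ᵥ w = 0 := by
  have h3 := A.mulVecLin.finrank_range_add_finrank_ker
  rw [Matrix.rank] at hA
  simp only [Module.finrank_fintype_fun_eq_card, Fintype.card_fin] at h3
  have h1 : 1 < Module.finrank ℂ (LinearMap.ker A.mulVecLin) := by omega
  have : Nontrivial (LinearMap.ker A.mulVecLin) :=
    Module.nontrivial_of_finrank_pos (R := ℂ) (by omega)
  obtain ⟨u, hu⟩ := exists_ne (0 : LinearMap.ker A.mulVecLin)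
  obtain ⟨w, hw⟩ := exists_linearIndependent_pair_of_one_lt_finrank h1 hu
  obtain ⟨a, ha⟩ : ∃ a, (u : Fin n → ℂ) a ≠ 0 := by
    by_contra! h
    exact hu (Subtype.ext (funext h))
  by_contra! H
  rw [LinearIndependent.pair_iff] at hw
  refine ha (neg_eq_zero.mp (hw ((w : Fin n → ℂ) a) (-(u : Fin n → ℂ) a) ?_).2)
  ext b
  by_contra hb
  refine H u w a b (fun h => hb ?_) u.2 w.2
  simp
  linear_combination -h

/-- Some nonzero combination of two independent kernel vectors vanishes at `j`, so it is still
killed after row `i` is replaced by a unit vector. -/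
theorem cofactor₁_eq_zero_of_rank_le {n : ℕ} (hn : 2 ≤ n) {A : Matrix (Fin n) (Fin n) ℂ}
    (hA : A.rank ≤ n - 2) (i j : Fin n) : cofactor₁ A i j = 0 := by
  obtain ⟨u, w, a, b, hab, hu, hw⟩ := exists_pair_of_rank_le hn hA
  have key : ∀ v : Fin n → ℂ, v ≠ 0 → v j = 0 → A *ᵥ v = 0 → cofactor₁ A i j = 0 := by
    intro v hv hvj hAv
    refine exists_mulVec_eq_zero_iff.mp ⟨v, hv, ?_⟩
    rw [updateRow_mulVec, hAv]
    simp [hvj]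
  by_cases huj : u j = 0
  · refine key u (fun h => hab ?_) huj hu
    simp [h]
  · refine key (u j • w - w j • u) (fun h => hab ?_) (by simp; ring) ?_
    · have hv : ∀ x, u j * w x - w j * u x = 0 := fun x => by simpa using congrFun h x
      refine (mul_eq_zero.mp ?_).resolve_left huj
      linear_combination u a * hv b - u b * hv a
    · rw [mulVec_sub, mulVec_smul, mulVec_smul, hu, hw]
      simp

/-! ### Rigidity and Zariski closure -/

theorem mem_rigiditySet_iff {n r s : ℕ} {M : Matrix (Fin n) (Fin n) ℂ} :
    M ∈ rigiditySet n r s ↔ ∃ A B : Matrix (Fin n) (Fin n) ℂ,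
      M = A + B ∧ A.rank ≤ r ∧ {p : Fin n × Fin n | B p.1 p.2 ≠ 0}.ncard ≤ s := by
  constructor
  · intro h
    have hne : {s : ℕ | ∃ A B : Matrix (Fin n) (Fin n) ℂ,
        M = A + B ∧ A.rank ≤ r ∧ {p : Fin n × Fin n | B p.1 p.2 ≠ 0}.ncard = s}.Nonempty :=
      ⟨_, Set.mem_ofPred.mpr ⟨0, M, by simp, by simp, rfl⟩⟩
    obtain ⟨A, B, h1, h2, h3⟩ := Nat.sInf_mem hne
    exact ⟨A, B, h1, h2, h3.trans_le h⟩
  · rintro ⟨A, B, h1, h2, h3⟩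
    exact le_trans (Nat.sInf_le (Set.mem_ofPred.mpr ⟨A, B, h1, h2, rfl⟩)) h3

theorem mem_rigiditySet_three {n r : ℕ} {M : Matrix (Fin n) (Fin n) ℂ} (p q t : Fin n × Fin n)
    {A : Matrix (Fin n) (Fin n) ℂ} (hA : A.rank ≤ r)
    (h : ∀ a b, (a, b) ≠ p → (a, b) ≠ q → (a, b) ≠ t → M a b = A a b) :
    M ∈ rigiditySet n r 3 := by
  refine mem_rigiditySet_iff.mpr ⟨A, M - A, by simp, hA, ?_⟩
  have hsub : {x : Fin n × Fin n | (M - A) x.1 x.2 ≠ 0} ⊆ (({p, q, t} : Finset _) : Set _) := by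
    rintro ⟨a, b⟩ hx
    by_contra hc
    simp only [Finset.coe_insert, Finset.coe_singleton, Set.mem_insert_iff,
      Set.mem_singleton_iff, not_or] at hc
    exact hx (by simp [h a b hc.1 hc.2.1 hc.2.2])
  refine (Set.ncard_le_ncard hsub (Finset.finite_toSet _)).trans ?_
  rw [Set.ncard_coe_finset]
  exact Finset.card_le_three

theorem exists_of_mem_rigiditySet_three {n r : ℕ} (hn : 0 < n) {M : Matrix (Fin n) (Fin n) ℂ}
    (hM : M ∈ rigiditySet n r 3) :
    ∃ (p q t : Fin n × Fin n) (A : Matrix (Fin n) (Fin n) ℂ), A.rank ≤ r ∧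
      ∀ a b, (a, b) ≠ p → (a, b) ≠ q → (a, b) ≠ t → M a b = A a b := by
  obtain ⟨A, B, rfl, hA, hB⟩ := mem_rigiditySet_iff.mp hM
  have hfin := Set.toFinite {p : Fin n × Fin n | B p.1 p.2 ≠ 0}
  rw [Set.ncard_eq_toFinset_card _ hfin] at hB
  set S := hfin.toFinset
  -- Fewer than three positions are padded by repetition.
  have key : ∃ p q t : Fin n × Fin n, S ⊆ {p, q, t} := by
    have : Nonempty (Fin n × Fin n) := ⟨(⟨0, hn⟩, ⟨0, hn⟩)⟩
    rcases Nat.lt_or_ge S.card 3 with h | h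
    · rcases Nat.lt_or_ge S.card 2 with h | h
      · obtain ⟨x, hx⟩ := Finset.card_le_one_iff_subset_singleton (s := S) |>.mp (by omega)
        exact ⟨x, x, x, by simpa using hx⟩
      · obtain ⟨x, y, -, hx⟩ := Finset.card_eq_two.mp (show S.card = 2 by omega)
        exact ⟨x, y, y, by simp [hx]⟩
    · obtain ⟨x, y, z, -, -, -, hx⟩ := Finset.card_eq_three.mp (show S.card = 3 by omega)
      exact ⟨x, y, z, by simp [hx]⟩
  obtain ⟨p, q, t, hpqt⟩ := key
  refine ⟨p, q, t, A, hA, fun a b h1 h2 h3 => ?_⟩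
  have : B a b = 0 := by
    by_contra hb
    have := hpqt (x := (a, b)) (by simpa [S] using hb)
    simp [h1, h2, h3] at this
  simp [this]

theorem subset_zariskiClosure {n : ℕ} (X : Set (Matrix (Fin n) (Fin n) ℂ)) :
    X ⊆ zariskiClosure X := fun _ hA _ hP => hP _ hA

theorem isClosed_zariskiClosure {n : ℕ} (X : Set (Matrix (Fin n) (Fin n) ℂ)) :
    IsClosed (zariskiClosure X) := by
  simp only [zariskiClosure, Set.ofPred_forall]
  refine isClosed_iInter fun P => isClosed_iInter fun _ => isClosed_eq ?_ continuous_const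
  exact (MvPolynomial.continuous_eval P).comp
    (continuous_pi fun p => continuous_id.matrix_elem p.1 p.2)

/-- Functions on matrices that are polynomial in the entries. -/
def IsPolynomialInEntries {n : ℕ} (f : Matrix (Fin n) (Fin n) ℂ → ℂ) : Prop :=
  ∃ P : MvPolynomial (Fin n × Fin n) ℂ, ∀ M, evalAt P M = f M

theorem IsPolynomialInEntries.const {n : ℕ} (c : ℂ) :
    IsPolynomialInEntries fun _ : Matrix (Fin n) (Fin n) ℂ => c :=
  ⟨MvPolynomial.C c, fun M => by simp [evalAt]⟩

theorem IsPolynomialInEntries.mul {n : ℕ} {f g : Matrix (Fin n) (Fin n) ℂ → ℂ}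
    (hf : IsPolynomialInEntries f) (hg : IsPolynomialInEntries g) :
    IsPolynomialInEntries fun M => f M * g M := by
  obtain ⟨P, hP⟩ := hf
  obtain ⟨Q, hQ⟩ := hg
  exact ⟨P * Q, fun M => by simp only [← hP, ← hQ]; simp [evalAt]⟩

theorem IsPolynomialInEntries.sub {n : ℕ} {f g : Matrix (Fin n) (Fin n) ℂ → ℂ}
    (hf : IsPolynomialInEntries f) (hg : IsPolynomialInEntries g) :
    IsPolynomialInEntries fun M => f M - g M := by
  obtain ⟨P, hP⟩ := hf
  obtain ⟨Q, hQ⟩ := hg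
  exact ⟨P - Q, fun M => by simp only [← hP, ← hQ]; simp [evalAt]⟩

theorem isPolynomialInEntries_minorOn {n : ℕ} (I J : Finset (Fin n)) :
    IsPolynomialInEntries fun M => minorOn M I J := by
  unfold minorOn
  split_ifs with h
  · refine ⟨((mvPolynomialX (Fin n) (Fin n) ℂ).submatrix (I.orderEmbOfFin rfl)
      (J.orderEmbOfFin h)).det, fun M => ?_⟩
    rw [evalAt, RingHom.map_det]
    congr 1
    ext a b
    simp
  · exact .const 0

theorem isPolynomialInEntries_delta₁ {n : ℕ} (i j : Fin n) :
    IsPolynomialInEntries fun M => delta₁ M i j :=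
  isPolynomialInEntries_minorOn _ _

theorem isPolynomialInEntries_delta₂ {n : ℕ} (i i' j j' : Fin n) :
    IsPolynomialInEntries fun M => delta₂ M i i' j j' :=
  (IsPolynomialInEntries.const _).mul (isPolynomialInEntries_minorOn _ _)

theorem exists_eq_zero_of_mem_zariskiClosure {n : ℕ} {κ : Type*} [Fintype κ]
    {X : Set (Matrix (Fin n) (Fin n) ℂ)} {f : κ → Matrix (Fin n) (Fin n) ℂ → ℂ}
    (hf : ∀ k, IsPolynomialInEntries (f k)) (hX : ∀ A ∈ X, ∃ k, f k A = 0)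
    {M : Matrix (Fin n) (Fin n) ℂ} (hM : M ∈ zariskiClosure X) : ∃ k, f k M = 0 := by
  choose P hP using hf
  have h : ∀ A, evalAt (∏ k, P k) A = ∏ k, f k A := fun A => by
    simp only [evalAt, map_prod, ← hP]
  have := hM (∏ k, P k) fun A hA => by
    obtain ⟨k, hk⟩ := hX A hA
    rw [h, Finset.prod_eq_zero (Finset.mem_univ k) hk]
  rw [h, Finset.prod_eq_zero_iff] at this
  obtain ⟨k, -, hk⟩ := this
  exact ⟨k, hk⟩

/-! ### Matrices with a vanishing minor of size `n - 1` -/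

/-- One changed entry in row `i` makes the columns other than `j` dependent. They then span
dimension at most `n - 2`, and two changes in column `j` move that column into their span. -/
theorem mem_rigiditySet_of_cofactor₁_eq_zero {n : ℕ} {M : Matrix (Fin n) (Fin n) ℂ} {i j : Fin n}
    (h : cofactor₁ M i j = 0) : M ∈ rigiditySet n (n - 2) 3 := by
  obtain ⟨v, hv, hMv⟩ := exists_mulVec_eq_zero_iff.mpr h
  rw [updateRow_mulVec] at hMv
  have hvj : v j = 0 := by simpa using congrFun hMv i
  have hva : ∀ a, a ≠ i → (M *ᵥ v) a = 0 := fun a ha => by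
    simpa [ha] using congrFun hMv a
  obtain ⟨j', hj'⟩ : ∃ j', v j' ≠ 0 := by
    by_contra! hc
    exact hv (funext hc)
  have hjj : j' ≠ j := fun h => hj' (h ▸ hvj)
  set N := M + single i j' (-(M *ᵥ v) i / v j') with hN
  have hNv : N *ᵥ v = 0 := by
    rw [hN, add_mulVec, single_mulVec]
    ext a
    rcases eq_or_ne a i with rfl | ha
    · simp [hj']
    · simp [ha, hva a ha]
  -- Since `v j = 0`, clearing column `j` keeps `v` in the kernel and adds the unit vector at `j`.
  have hrank : (N.updateCol j 0).rank ≤ n - 2 := by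
    refine rank_le_sub_two (u := v) (w := Pi.single j 1) (a := j') (b := j)
      (by simpa [hvj] using hj') ?_ ?_
    · ext a
      rw [← hNv]
      simp only [mulVec, dotProduct]
      refine Finset.sum_congr rfl fun k _ => ?_
      rcases eq_or_ne k j with rfl | hk
      · simp [hvj]
      · simp [hk]
    · ext a
      simp
  rw [← rank_transpose] at hrank
  obtain ⟨u, w, a, b, hab, hu, hw⟩ := exists_pair_of_rank_le
    (Nat.one_lt_iff_ne_zero_and_ne_one.mpr ⟨by rintro rfl; exact i.elim0, by
      rintro rfl; exact hjj (Subsingleton.elim _ _)⟩) hrank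
  set p := (Nᵀ *ᵥ u) j with hp
  set q := (Nᵀ *ᵥ w) j with hq
  -- The two corrections solve, by Cramer's rule, the system making column `j` orthogonal to both
  -- `u` and `w`.
  set B := N + single a j ((q * u b - p * w b) / (u a * w b - u b * w a))
    + single b j ((p * w a - q * u a) / (u a * w b - u b * w a)) with hB
  have hBx : ∀ x : Fin n → ℂ, (N.updateCol j 0)ᵀ *ᵥ x = 0 →
      (Nᵀ *ᵥ x) j + (q * u b - p * w b) / (u a * w b - u b * w a) * x a
        + (p * w a - q * u a) / (u a * w b - u b * w a) * x b = 0 → Bᵀ *ᵥ x = 0 := by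
    intro x hx hxj
    rw [hB, transpose_add, transpose_add, transpose_single, transpose_single, add_mulVec,
      add_mulVec, single_mulVec, single_mulVec]
    ext k
    rcases eq_or_ne k j with rfl | hk
    · simpa using hxj
    · have := congrFun hx k
      rw [← updateRow_transpose, updateRow_mulVec] at this
      simpa [hk] using this
  obtain ⟨δ, hδ⟩ : ∃ δ, u a * w b - u b * w a = δ := ⟨_, rfl⟩
  have hδ0 : δ ≠ 0 := hδ ▸ hab
  have hBrank : Bᵀ.rank ≤ n - 2 := by
    refine rank_le_sub_two hab (hBx u hu ?_) (hBx w hw ?_)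
    · rw [← hp, hδ]
      field_simp
      rw [← hδ]
      ring
    · rw [← hq, hδ]
      field_simp
      rw [← hδ]
      ring
  rw [rank_transpose] at hBrank
  refine mem_rigiditySet_three (i, j') (a, j) (b, j) hBrank fun x y h1 h2 h3 => ?_
  have e : ∀ (s : Fin n) (t : Fin n) (c : ℂ), (x, y) ≠ (s, t) → single s t c x y = 0 := by
    intro s t c hst
    rw [single_apply, if_neg]
    rintro ⟨rfl, rfl⟩
    exact hst rfl
  simp [hB, hN, e _ _ _ h1, e _ _ _ h2, e _ _ _ h3]

/-! ### Matrices of the rigidity set satisfy one of the equations -/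

theorem cofactorDet_eq_zero {n : ℕ} (hn : 2 ≤ n) {A B : Matrix (Fin n) (Fin n) ℂ}
    {i₁ i₂ i₃ j₁ j₂ j₃ : Fin n} (hi₁₃ : i₁ ≠ i₃) (hi₂₃ : i₂ ≠ i₃)
    (hj₁₃ : j₁ ≠ j₃) (hj₂₃ : j₂ ≠ j₃) (hB : B.rank ≤ n - 2)
    (h : ∀ a b, (a, b) ≠ (i₁, j₂) → (a, b) ≠ (i₂, j₁) → (a, b) ≠ (i₃, j₃) → A a b = B a b) :
    cofactorDet A i₁ i₂ i₃ j₁ j₂ j₃ = 0 := by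
  -- Either deletion removes the first two positions, so only the third contributes, linearly, to a
  -- minor that is zero for `B`.
  have h1 : ∀ i j, (i = i₁ ∧ j = j₁ ∨ i = i₂ ∧ j = j₂) →
      cofactor₁ A i j = (A i₃ j₃ - B i₃ j₃) * cofactor₂ B i i₃ j j₃ := by
    intro i j hij
    have hi : i ≠ i₃ := by rcases hij with ⟨rfl, rfl⟩ | ⟨rfl, rfl⟩ <;> assumption
    rw [← zero_add (_ * _), ← cofactor₁_eq_zero_of_rank_le hn hB i j,
      ← cofactor₁_add_single B _ _ _ hi]
    refine cofactor₁_congr fun a b ha hb => ?_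
    by_cases hab : i₃ = a ∧ j₃ = b
    · obtain ⟨rfl, rfl⟩ := hab
      simp
    · rw [Matrix.add_apply, single_apply, if_neg hab, add_zero]
      refine h a b ?_ ?_ ?_ <;> simp only [ne_eq, Prod.mk.injEq] <;> grind
  have h2 : ∀ i j, (i = i₁ ∧ j = j₁ ∨ i = i₂ ∧ j = j₂) →
      cofactor₂ A i i₃ j j₃ = cofactor₂ B i i₃ j j₃ := by
    intro i j hij
    refine cofactor₂_congr (by grind) (by grind) fun a b ha ha' hb hb' => ?_
    refine h a b ?_ ?_ ?_ <;> simp only [ne_eq, Prod.mk.injEq] <;> grind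
  rw [cofactorDet, h1 i₁ j₁ (by simp), h1 i₂ j₂ (by simp), h2 i₁ j₁ (by simp), h2 i₂ j₂ (by simp)]
  ring

theorem exists_cofactor_eq_zero_of_mem_rigiditySet {n : ℕ} (hn : 2 ≤ n)
    {A : Matrix (Fin n) (Fin n) ℂ} (hA : A ∈ rigiditySet n (n - 2) 3) :
    (∃ i j, cofactor₁ A i j = 0) ∨
      ∃ i₁ i₂ i₃ j₁ j₂ j₃ : Fin n, i₁ ≠ i₂ ∧ i₁ ≠ i₃ ∧ i₂ ≠ i₃ ∧ j₁ ≠ j₂ ∧ j₁ ≠ j₃ ∧ j₂ ≠ j₃ ∧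
        cofactorDet A i₁ i₂ i₃ j₁ j₂ j₃ = 0 := by
  -- The column labels are crossed so that deleting `(i₁, j₁)` or `(i₂, j₂)` hits both of the first
  -- two positions.
  obtain ⟨⟨i₁, j₂⟩, ⟨i₂, j₁⟩, ⟨i₃, j₃⟩, B, hB, h⟩ :=
    exists_of_mem_rigiditySet_three (by omega) hA
  have cover : ∀ i j, (i₁ = i ∨ j₂ = j) → (i₂ = i ∨ j₁ = j) → (i₃ = i ∨ j₃ = j) →
      cofactor₁ A i j = 0 := by
    intro i j h1 h2 h3
    rw [← cofactor₁_eq_zero_of_rank_le hn hB i j]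
    refine cofactor₁_congr fun a b ha hb => ?_
    refine h a b ?_ ?_ ?_ <;> simp only [ne_eq, Prod.mk.injEq] <;> grind
  by_cases hi₁₂ : i₁ = i₂
  · exact .inl ⟨i₁, j₃, cover _ _ (by simp) (by simp [hi₁₂]) (by simp)⟩
  by_cases hi₁₃ : i₁ = i₃
  · exact .inl ⟨i₁, j₁, cover _ _ (by simp) (by simp) (by simp [hi₁₃])⟩
  by_cases hi₂₃ : i₂ = i₃
  · exact .inl ⟨i₂, j₂, cover _ _ (by simp) (by simp) (by simp [hi₂₃])⟩
  by_cases hj₁₂ : j₁ = j₂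
  · exact .inl ⟨i₃, j₁, cover _ _ (by simp [hj₁₂]) (by simp) (by simp)⟩
  by_cases hj₁₃ : j₁ = j₃
  · exact .inl ⟨i₁, j₁, cover _ _ (by simp) (by simp) (by simp [hj₁₃])⟩
  by_cases hj₂₃ : j₂ = j₃
  · exact .inl ⟨i₂, j₂, cover _ _ (by simp) (by simp) (by simp [hj₂₃])⟩
  exact .inr ⟨i₁, i₂, i₃, j₁, j₂, j₃, hi₁₂, hi₁₃, hi₂₃, hj₁₂, hj₁₃, hj₂₃,
    cofactorDet_eq_zero hn hi₁₃ hi₂₃ hj₁₃ hj₂₃ hB h⟩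

/-! ### Invertible matrices on which a polynomial of the second kind vanishes -/

theorem cofactor₁_eq_det_mul_inv {n : ℕ} {M : Matrix (Fin n) (Fin n) ℂ} (hM : M.det ≠ 0)
    (i j : Fin n) : cofactor₁ M i j = M.det * M⁻¹ j i := by
  rw [inv_def, Matrix.smul_apply, Ring.inverse_eq_inv', smul_eq_mul, mul_inv_cancel_left₀ hM,
    adjugate_apply, cofactor₁]

/-- Replacing two rows is a rank-two perturbation of the identity, so `det (1 + U V) = det (1 + V
U)` reduces to size two. -/
theorem det_one_updateRow_updateRow {n : ℕ} {i i' : Fin n} (hi : i ≠ i') (u w : Fin n → ℂ) :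
    (((1 : Matrix (Fin n) (Fin n) ℂ).updateRow i u).updateRow i' w).det
      = u i * w i' - u i' * w i := by
  have h : ((1 : Matrix (Fin n) (Fin n) ℂ).updateRow i u).updateRow i' w
      = 1 + (of ![Pi.single i 1, Pi.single i' 1] : Matrix (Fin 2) (Fin n) ℂ)ᵀ
        * (of ![u - Pi.single i 1, w - Pi.single i' 1] : Matrix (Fin 2) (Fin n) ℂ) := by
    ext a b
    rcases eq_or_ne a i' with rfl | ha'
    · simp [mul_apply, Fin.sum_univ_two, Pi.single_apply, one_apply, hi.symm, eq_comm]
    · rcases eq_or_ne a i with rfl | ha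
      · simp [mul_apply, Fin.sum_univ_two, Pi.single_apply, one_apply, hi, eq_comm]
      · simp [mul_apply, Fin.sum_univ_two, Pi.single_apply, ha, ha']
  have h2 : (of ![u - Pi.single i 1, w - Pi.single i' 1] : Matrix (Fin 2) (Fin n) ℂ)
      * (of ![Pi.single i 1, Pi.single i' 1] : Matrix (Fin 2) (Fin n) ℂ)ᵀ
      = !![u i - 1, u i'; w i, w i' - 1] := by
    ext a b
    fin_cases a <;> fin_cases b <;> simp [mul_apply, Pi.single_apply, hi, hi.symm]
  rw [h, det_one_add_mul_comm, h2, det_fin_two]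
  simp

/-- Jacobi's identity: the inserted unit vectors are rows of `M⁻¹` times `M`, so `M` factors out on
the right. -/
theorem cofactor₂_eq_det_mul_inv {n : ℕ} {M : Matrix (Fin n) (Fin n) ℂ} (hM : M.det ≠ 0)
    {i i' : Fin n} (hi : i ≠ i') (j j' : Fin n) :
    cofactor₂ M i i' j j' = M.det * (M⁻¹ j i * M⁻¹ j' i' - M⁻¹ j i' * M⁻¹ j' i) := by
  have h1 : ∀ j, M⁻¹ j ᵥ* M = Pi.single j 1 := fun j => by
    have := congrFun (nonsing_inv_mul M (isUnit_iff_ne_zero.mpr hM)) j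
    rw [mul_apply_eq_vecMul] at this
    rw [this]
    ext k
    simp [one_apply, Pi.single_apply, eq_comm]
  rw [← det_one_updateRow_updateRow hi, mul_comm, ← det_mul, updateRow_mul, updateRow_mul, h1, h1,
    one_mul, cofactor₂]

/-- The term `M⁻¹ j₁ i₁ * M⁻¹ j₂ i₂ * M⁻¹ j₃ i₃` cancels. For the pairing `(j₂, i₁)`, `(j₁, i₂)`,
`(j₃, i₃)` as diagonal, the two remaining terms are the off-diagonal 3-cycles. -/
theorem cofactorDet_eq_det_mul_inv {n : ℕ} {M : Matrix (Fin n) (Fin n) ℂ} (hM : M.det ≠ 0)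
    {i₁ i₂ i₃ : Fin n} (hi₁₃ : i₁ ≠ i₃) (hi₂₃ : i₂ ≠ i₃) (j₁ j₂ j₃ : Fin n) :
    cofactorDet M i₁ i₂ i₃ j₁ j₂ j₃ = M.det ^ 2 *
      (M⁻¹ j₂ i₂ * M⁻¹ j₁ i₃ * M⁻¹ j₃ i₁ - M⁻¹ j₂ i₃ * M⁻¹ j₃ i₂ * M⁻¹ j₁ i₁) := by
  rw [cofactorDet, cofactor₁_eq_det_mul_inv hM, cofactor₁_eq_det_mul_inv hM,
    cofactor₂_eq_det_mul_inv hM hi₂₃, cofactor₂_eq_det_mul_inv hM hi₁₃]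
  ring

/-- If the three-by-three submatrix of `M⁻¹` on rows `j₁, j₂, j₃` and columns `i₁, i₂, i₃` becomes
of rank one after subtracting an invertible diagonal matrix, then changing the entries `(i₁, j₁)`,
`(i₂, j₂)`, `(i₃, j₃)` of `M` can make its rank drop by two. -/
theorem mem_rigiditySet_of_inv {n : ℕ} {M : Matrix (Fin n) (Fin n) ℂ} (hM : M.det ≠ 0)
    {i₁ i₂ i₃ j₁ j₂ j₃ : Fin n} (hi₁₂ : i₁ ≠ i₂) (hi₁₃ : i₁ ≠ i₃) (hi₂₃ : i₂ ≠ i₃)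
    {d₁ d₂ d₃ a₁ a₂ a₃ b₁ b₂ b₃ : ℂ} (hd₁ : d₁ ≠ 0) (hd₂ : d₂ ≠ 0) (hd₃ : d₃ ≠ 0) (hb₁ : b₁ ≠ 0)
    (h₁₁ : M⁻¹ j₁ i₁ = d₁ + a₁ * b₁) (h₁₂ : M⁻¹ j₁ i₂ = a₁ * b₂) (h₁₃ : M⁻¹ j₁ i₃ = a₁ * b₃)
    (h₂₁ : M⁻¹ j₂ i₁ = a₂ * b₁) (h₂₂ : M⁻¹ j₂ i₂ = d₂ + a₂ * b₂) (h₂₃ : M⁻¹ j₂ i₃ = a₂ * b₃)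
    (h₃₁ : M⁻¹ j₃ i₁ = a₃ * b₁) (h₃₂ : M⁻¹ j₃ i₂ = a₃ * b₂) (h₃₃ : M⁻¹ j₃ i₃ = d₃ + a₃ * b₃) :
    M ∈ rigiditySet n (n - 2) 3 := by
  set C : Matrix (Fin n) (Fin n) ℂ :=
    single i₁ j₁ d₁⁻¹ + single i₂ j₂ d₂⁻¹ + single i₃ j₃ d₃⁻¹ with hC
  -- On such vectors the rank-one part vanishes, so `M⁻¹` multiplies by the `d`'s in rows `j₁, j₂,
  -- j₃`, and `C` undoes this.
  have hker : ∀ y₁ y₂ y₃ : ℂ, b₁ * y₁ + b₂ * y₂ + b₃ * y₃ = 0 →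
      (1 - C * M⁻¹) *ᵥ (Pi.single i₁ y₁ + Pi.single i₂ y₂ + Pi.single i₃ y₃) = 0 := by
    intro y₁ y₂ y₃ hy
    set y : Fin n → ℂ := Pi.single i₁ y₁ + Pi.single i₂ y₂ + Pi.single i₃ y₃ with hydef
    have hG : ∀ j, (M⁻¹ *ᵥ y) j = M⁻¹ j i₁ * y₁ + M⁻¹ j i₂ * y₂ + M⁻¹ j i₃ * y₃ := fun j => by
      simp [hydef, mulVec_add, mul_comm]
    have e₁ : d₁⁻¹ * (M⁻¹ *ᵥ y) j₁ = y₁ := by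
      rw [hG, h₁₁, h₁₂, h₁₃]
      field_simp
      linear_combination a₁ * hy
    have e₂ : d₂⁻¹ * (M⁻¹ *ᵥ y) j₂ = y₂ := by
      rw [hG, h₂₁, h₂₂, h₂₃]
      field_simp
      linear_combination a₂ * hy
    have e₃ : d₃⁻¹ * (M⁻¹ *ᵥ y) j₃ = y₃ := by
      rw [hG, h₃₁, h₃₂, h₃₃]
      field_simp
      linear_combination a₃ * hy
    rw [sub_mulVec, one_mulVec, ← mulVec_mulVec, hC, add_mulVec, add_mulVec, single_mulVec,
      single_mulVec, single_mulVec, e₁, e₂, e₃, sub_eq_zero]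
    rfl
  have hrank : (1 - C * M⁻¹).rank ≤ n - 2 := by
    -- The minor of the two chosen kernel vectors at `i₂, i₃` is `b₁ ^ 2`.
    refine rank_le_sub_two (a := i₂) (b := i₃) ?_ (hker b₂ (-b₁) 0 (by ring))
      (hker b₃ 0 (-b₁) (by ring))
    simp [hi₂₃, hi₁₂.symm, hi₁₃.symm, hi₂₃.symm, hb₁]
  have hMC : (1 - C * M⁻¹) * M = M - C := by
    rw [sub_mul, one_mul, mul_assoc, nonsing_inv_mul _ (isUnit_iff_ne_zero.mpr hM), mul_one]
  refine mem_rigiditySet_three (i₁, j₁) (i₂, j₂) (i₃, j₃)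
    (hMC ▸ (rank_mul_le_left _ _).trans hrank) fun x y h1 h2 h3 => ?_
  have e : ∀ (s : Fin n) (t : Fin n) (c : ℂ), (x, y) ≠ (s, t) → single s t c x y = 0 := by
    intro s t c hst
    rw [single_apply, if_neg]
    rintro ⟨rfl, rfl⟩
    exact hst rfl
  simp [hC, e _ _ _ h1, e _ _ _ h2, e _ _ _ h3]

/-! ### Limits of matrices of low rigidity -/

theorem eventually_add_ne_zero (d : ℂ) : ∀ᶠ t in 𝓝[≠] (0 : ℂ), d + t ≠ 0 := by
  by_cases hd : d = 0
  · filter_upwards [self_mem_nhdsWithin] with t ht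
    simpa [hd] using ht
  · refine nhdsWithin_le_nhds (ContinuousAt.eventually_ne (by fun_prop) (by simpa using hd))

/-- The off-diagonal entries determine the rank-one part, but the diagonal remainder may have zeros.
Adding `t • E` shifts only the diagonal and removes them for small nonzero `t`. -/
theorem mem_closure_rigiditySet_of_inv {n : ℕ} {M : Matrix (Fin n) (Fin n) ℂ} (hM : M.det ≠ 0)
    {i₁ i₂ i₃ j₁ j₂ j₃ : Fin n} (hi₁₂ : i₁ ≠ i₂) (hi₁₃ : i₁ ≠ i₃) (hi₂₃ : i₂ ≠ i₃)
    (hj₁₂ : j₁ ≠ j₂) (hj₁₃ : j₁ ≠ j₃) (hj₂₃ : j₂ ≠ j₃)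
    (h₁₂ : M⁻¹ j₁ i₂ ≠ 0) (h₁₃ : M⁻¹ j₁ i₃ ≠ 0) (h₂₁ : M⁻¹ j₂ i₁ ≠ 0) (h₂₃ : M⁻¹ j₂ i₃ ≠ 0)
    (h : M⁻¹ j₁ i₂ * M⁻¹ j₂ i₃ * M⁻¹ j₃ i₁ = M⁻¹ j₁ i₃ * M⁻¹ j₃ i₂ * M⁻¹ j₂ i₁) :
    M ∈ closure (rigiditySet n (n - 2) 3) := by
  set E : Matrix (Fin n) (Fin n) ℂ := single j₁ i₁ 1 + single j₂ i₂ 1 + single j₃ i₃ 1 with hE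
  set G := M⁻¹ with hG
  have hGdet : G.det ≠ 0 := by
    rw [hG, det_nonsing_inv, Ring.inverse_eq_inv']
    exact inv_ne_zero hM
  have hcont : Continuous fun t : ℂ => G + t • E := by fun_prop
  have hlim : Tendsto (fun t : ℂ => (G + t • E)⁻¹) (𝓝[≠] 0) (𝓝 M) := by
    have h0 : M = (G + (0 : ℂ) • E)⁻¹ := by
      rw [zero_smul, add_zero, hG, nonsing_inv_nonsing_inv _ (isUnit_iff_ne_zero.mpr hM)]
    rw [h0]
    refine Tendsto.mono_left ?_ nhdsWithin_le_nhds
    have hinv : ContinuousAt Ring.inverse (G + (0 : ℂ) • E).det := by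
      rw [zero_smul, add_zero, Ring.inverse_eq_inv']
      exact continuousAt_inv₀ hGdet
    exact (continuousAt_matrix_inv (G + (0 : ℂ) • E) hinv).tendsto.comp hcont.continuousAt
  refine mem_closure_of_tendsto hlim ?_
  have hdet : ∀ᶠ t in 𝓝[≠] (0 : ℂ), (G + t • E).det ≠ 0 :=
    nhdsWithin_le_nhds (ContinuousAt.eventually_ne hcont.matrix_det.continuousAt (by simpa))
  filter_upwards [hdet, eventually_add_ne_zero (G j₁ i₁ - G j₁ i₃ * G j₂ i₁ / G j₂ i₃),
    eventually_add_ne_zero (G j₂ i₂ - G j₂ i₃ / G j₁ i₃ * G j₁ i₂),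
    eventually_add_ne_zero (G j₃ i₃ - G j₃ i₂ / G j₁ i₂ * G j₁ i₃)] with t ht hd₁ hd₂ hd₃
  have hinv : (G + t • E)⁻¹⁻¹ = G + t • E :=
    nonsing_inv_nonsing_inv _ (isUnit_iff_ne_zero.mpr ht)
  -- Normalising `a₁ = 1`, five off-diagonal entries fix the other factors; the sixth, at `(j₃,
  -- i₁)`, is matched by `h`.
  refine mem_rigiditySet_of_inv (M := (G + t • E)⁻¹) (j₁ := j₁) (j₂ := j₂) (j₃ := j₃) ?_ hi₁₂ hi₁₃ hi₂₃
    (a₁ := 1) (b₂ := G j₁ i₂) (b₃ := G j₁ i₃) (a₂ := G j₂ i₃ / G j₁ i₃)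
    (a₃ := G j₃ i₂ / G j₁ i₂) (b₁ := G j₁ i₃ * G j₂ i₁ / G j₂ i₃) hd₁ hd₂ hd₃
    (div_ne_zero (mul_ne_zero h₁₃ h₂₁) h₂₃)
    ?_ ?_ ?_ ?_ ?_ ?_ ?_ ?_ ?_
  · rw [det_nonsing_inv, Ring.inverse_eq_inv']
    exact inv_ne_zero ht
  all_goals
    rw [hinv]
    simp only [hE, Matrix.add_apply, Matrix.smul_apply, single_apply, hi₁₂, hi₁₃, hi₂₃, hj₁₂, hj₁₃, hj₂₃,
      hi₁₂.symm, hi₁₃.symm, hi₂₃.symm, hj₁₂.symm, hj₁₃.symm, hj₂₃.symm, and_self, and_true, and_false,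
      if_true, if_false, smul_eq_mul]
    simp only [mul_zero, mul_one, add_zero, zero_add]
    field_simp
    try first | ring1 | linear_combination h

theorem mem_zariskiClosure_of_cofactorDet_eq_zero {n : ℕ} {M : Matrix (Fin n) (Fin n) ℂ}
    {i₁ i₂ i₃ j₁ j₂ j₃ : Fin n} (hi₁₂ : i₁ ≠ i₂) (hi₁₃ : i₁ ≠ i₃) (hi₂₃ : i₂ ≠ i₃)
    (hj₁₂ : j₁ ≠ j₂) (hj₁₃ : j₁ ≠ j₃) (hj₂₃ : j₂ ≠ j₃)
    (h : cofactorDet M i₁ i₂ i₃ j₁ j₂ j₃ = 0) :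
    M ∈ zariskiClosure (rigiditySet n (n - 2) 3) := by
  by_cases h0 : ∃ i j, cofactor₁ M i j = 0
  · obtain ⟨i, j, hij⟩ := h0
    exact subset_zariskiClosure _ (mem_rigiditySet_of_cofactor₁_eq_zero hij)
  push Not at h0
  have hreg : ∀ N : Matrix (Fin n) (Fin n) ℂ, N.det ≠ 0 → cofactorDet N i₁ i₂ i₃ j₁ j₂ j₃ = 0 →
      N ∈ zariskiClosure (rigiditySet n (n - 2) 3) := by
    intro N hN hN0
    by_cases h0 : ∃ i j, cofactor₁ N i j = 0
    · obtain ⟨i, j, hij⟩ := h0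
      exact subset_zariskiClosure _ (mem_rigiditySet_of_cofactor₁_eq_zero hij)
    push Not at h0
    have hinv : ∀ i j, N⁻¹ j i ≠ 0 := fun i j =>
      right_ne_zero_of_mul (cofactor₁_eq_det_mul_inv hN i j ▸ h0 i j)
    rw [cofactorDet_eq_det_mul_inv hN hi₁₃ hi₂₃] at hN0
    refine closure_minimal (subset_zariskiClosure _) (isClosed_zariskiClosure _)
      (mem_closure_rigiditySet_of_inv hN hi₁₂ hi₁₃ hi₂₃ hj₁₂.symm hj₂₃ hj₁₃
      (hinv _ _) (hinv _ _) (hinv _ _) (hinv _ _) ?_)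
    exact sub_eq_zero.mp ((mul_eq_zero.mp hN0).resolve_left (pow_ne_zero 2 hN))
  by_cases hdet : M.det = 0
  -- Entry `(i₁, j₂)` lies in a deleted row or column of all four minors in `cofactorDet`, while the
  -- determinant varies with it at a nonzero rate.
  · have hlim : Tendsto (fun t : ℂ => M + single i₁ j₂ t) (𝓝[≠] 0) (𝓝 M) := by
      have hc : Continuous fun t : ℂ => M + single i₁ j₂ t := by
        refine continuous_const.add (continuous_matrix fun a b => ?_)
        simp only [single_apply]
        split_ifs <;> fun_prop
      simpa using hc.continuousAt.tendsto.mono_left (nhdsWithin_le_nhds (a := (0 : ℂ)))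
    refine (isClosed_zariskiClosure _).mem_of_tendsto hlim ?_
    filter_upwards [self_mem_nhdsWithin] with t ht
    refine hreg _ ?_ ?_
    · rw [det_add_single, hdet, zero_add]
      exact mul_ne_zero ht (h0 _ _)
    · rw [← h, cofactorDet, cofactorDet]
      congr 2
      · exact cofactor₁_congr fun a b ha hb => by simp [ha.symm]
      · exact cofactor₂_congr hi₂₃ hj₂₃ fun a b _ _ hb _ => by simp [hb.symm]
      · exact cofactor₁_congr fun a b ha hb => by simp [hb.symm]
      · exact cofactor₂_congr hi₁₃ hj₁₃ fun a b ha _ _ _ => by simp [ha.symm]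
  · exact hreg M hdet h

/-! ### The criterion for maximal border rigidity -/

theorem mainTheorem7 (n : ℕ) (hn : 2 ≤ n) (M : Matrix (Fin n) (Fin n) ℂ) :
    IsMaximallyBorderRigid (n - 2) M ↔
      (∀ I J : Finset (Fin n), I.card = n - 1 → J.card = n - 1 → minorOn M I J ≠ 0) ∧
      (∀ i₁ i₂ i₃ j₁ j₂ j₃ : Fin n,
        i₁ ≠ i₂ → i₁ ≠ i₃ → i₂ ≠ i₃ → j₁ ≠ j₂ → j₁ ≠ j₃ → j₂ ≠ j₃ →
          delta₁ M i₁ j₁ * delta₂ M i₂ i₃ j₂ j₃ - delta₁ M i₂ j₂ * delta₂ M i₁ i₃ j₁ j₃ ≠ 0) := by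
  have h3 : (n - (n - 2)) ^ 2 - 1 = 3 := by
    rw [Nat.sub_sub_self hn]
    rfl
  have hcompl : ∀ I : Finset (Fin n), I.card = n - 1 → ∃ i, I = {i}ᶜ := by
    intro I hI
    obtain ⟨i, hi⟩ := Finset.card_eq_one.mp
      (show Iᶜ.card = 1 by rw [Finset.card_compl, Fintype.card_fin]; omega)
    exact ⟨i, by rw [← hi, compl_compl]⟩
  rw [IsMaximallyBorderRigid, borderRigidityVariety, h3]
  constructor
  · intro h
    refine ⟨fun I J hI hJ h0 => h ?_,
      fun i₁ i₂ i₃ j₁ j₂ j₃ hi₁₂ hi₁₃ hi₂₃ hj₁₂ hj₁₃ hj₂₃ h0 => h ?_⟩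
    · obtain ⟨i, rfl⟩ := hcompl I hI
      obtain ⟨j, rfl⟩ := hcompl J hJ
      refine subset_zariskiClosure _ (mem_rigiditySet_of_cofactor₁_eq_zero (i := i) (j := j) ?_)
      rw [cofactor₁_eq, delta₁, h0, mul_zero]
    · refine mem_zariskiClosure_of_cofactorDet_eq_zero hi₁₂ hi₁₃ hi₂₃ hj₁₂ hj₁₃ hj₂₃ ?_
      rw [cofactorDet_eq M hi₁₃ hi₂₃ hj₁₃ hj₂₃, h0, mul_zero]
  · rintro ⟨h1, h2⟩ hM
    let f : (Fin n × Fin n) ⊕ ((Fin 3 ↪ Fin n) × (Fin 3 ↪ Fin n)) →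
        Matrix (Fin n) (Fin n) ℂ → ℂ :=
      Sum.elim (fun p A => delta₁ A p.1 p.2) fun p A =>
        delta₁ A (p.1 0) (p.2 0) * delta₂ A (p.1 1) (p.1 2) (p.2 1) (p.2 2)
          - delta₁ A (p.1 1) (p.2 1) * delta₂ A (p.1 0) (p.1 2) (p.2 0) (p.2 2)
    have hf : ∀ k, IsPolynomialInEntries (f k) := by
      rintro (p | p)
      · exact isPolynomialInEntries_delta₁ _ _
      · exact ((isPolynomialInEntries_delta₁ _ _).mul (isPolynomialInEntries_delta₂ _ _ _ _)).sub
          ((isPolynomialInEntries_delta₁ _ _).mul (isPolynomialInEntries_delta₂ _ _ _ _))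
    have hX : ∀ A ∈ rigiditySet n (n - 2) 3, ∃ k, f k A = 0 := by
      intro A hA
      have hsign : ∀ k : ℕ, (-1 : ℂ) ^ k ≠ 0 := fun k => pow_ne_zero k (by norm_num)
      rcases exists_cofactor_eq_zero_of_mem_rigiditySet hn hA with ⟨i, j, h⟩ |
        ⟨i₁, i₂, i₃, j₁, j₂, j₃, hi₁₂, hi₁₃, hi₂₃, hj₁₂, hj₁₃, hj₂₃, h⟩
      · rw [cofactor₁_eq] at h
        exact ⟨.inl (i, j), (mul_eq_zero.mp h).resolve_left (hsign _)⟩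
      · rw [cofactorDet_eq A hi₁₃ hi₂₃ hj₁₃ hj₂₃] at h
        have hinj : ∀ {a b c : Fin n}, a ≠ b → a ≠ c → b ≠ c →
            Function.Injective ![a, b, c] := by
          intro a b c hab hac hbc x y hxy
          fin_cases x <;> fin_cases y <;> simp_all
        exact ⟨.inr (⟨_, hinj hi₁₂ hi₁₃ hi₂₃⟩, ⟨_, hinj hj₁₂ hj₁₃ hj₂₃⟩),
          (mul_eq_zero.mp h).resolve_left (hsign _)⟩
    obtain ⟨⟨i, j⟩ | ⟨e, e'⟩, hk⟩ := exists_eq_zero_of_mem_zariskiClosure hf hX hM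
    · exact h1 {i}ᶜ {j}ᶜ (by simp [Finset.card_compl]) (by simp [Finset.card_compl]) hk
    · have hne : ∀ (e : Fin 3 ↪ Fin n) (a b : Fin 3), a ≠ b → e a ≠ e b :=
        fun e _ _ hab => e.injective.ne hab
      exact h2 _ _ _ _ _ _ (hne e 0 1 (by decide)) (hne e 0 2 (by decide))
        (hne e 1 2 (by decide)) (hne e' 0 1 (by decide)) (hne e' 0 2 (by decide))
        (hne e' 1 2 (by decide)) hk
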